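/- Let $n\in\mathbb N$, let $-\infty\le a<b\le\infty$, and let $A:(a,b)\to\mathbb R^{n\times n}$ be a matrix function whose entries are measurable and locally essentially bounded on $(a,b)$ (i.e. essentially bounded on every compact subinterval of $(a,b)$). Suppose that for almost every $t\in(a,b)$ the matrix $A(t)=(a_{ij}(t))$ is tridiagonal ($a_{ij}(t)=0$ whenever $|i-j|>1$) with positive entries on the sub- and super-diagonal and, furthermore, that there is $\delta>0$ such that for almost every $t\in(a,b)$ we have $a_{ij}(t)\ge\delta$ for all $i,j$ with $|i-j|=1$. Then the system $\dot\Phi=A(t)\Phi$ is a totally positive differential system (TPDS) on $(a,b)$: its transition matrix $\Phi(t,t_0)$ exists and, for all $a<t_0<t<b$, the matrix $\Phi(t,t_0)$ is totally positive, i.e. the determinant of every square submatrix of $\Phi(t,t_0)$ is positive. Here, a transition matrix is a family $\Phi(t,t_0)\in\mathbb R^{n\times n}$, $t,t_0\in(a,b)$, such that for every $t_0\in(a,b)$ the function $t\mapsto\Phi(t,t_0)$ is locally absolutely continuous on $(a,b)$, satisfies $\frac{d}{dt}\Phi(t,t_0)=A(t)\Phi(t,t_0)$ for almost every $t\in(a,b)$,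 and $\Phi(t_0,t_0)=I$; the assertion holds for every such family. -/

import Mathlib

open MeasureTheory Set

/-- The open time interval `(a, b)` of real numbers, where `-∞ ≤ a` and `b ≤ ∞`. -/
def timeInterval (a b : EReal) : Set ℝ := {t : ℝ | a < (t : EReal) ∧ (t : EReal) < b}

/-- Totally positive matrices: the determinant of every square submatrix (rows and columns taken
in increasing order) is positive. -/
def Matrix.IsTotallyPositive {n : ℕ} (M : Matrix (Fin n) (Fin n) ℝ) : Prop :=
  ∀ (k : ℕ) (r c : Fin k ↪o Fin n), 0 < (M.submatrix r c).det

/-- Tridiagonal matrices: `M i j = 0` whenever `|i - j| > 1`. -/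
def Matrix.IsTridiag {n : ℕ} (M : Matrix (Fin n) (Fin n) ℝ) : Prop :=
  ∀ i j : Fin n, 1 < |(i : ℤ) - (j : ℤ)| → M i j = 0

/-- The class `𝓜⁺` of tridiagonal matrices with positive entries on the sub- and
super-diagonal. -/
def Matrix.IsMPlus {n : ℕ} (M : Matrix (Fin n) (Fin n) ℝ) : Prop :=
  M.IsTridiag ∧ ∀ i j : Fin n, |(i : ℤ) - (j : ℤ)| = 1 → 0 < M i j

/-- The standing assumption on the coefficient matrix: its entries are (Lebesgue) measurable and
locally essentially bounded functions on `(a, b)`. Values of `A` off `(a, b)` are irrelevant. -/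
def IsLocEssBddMeas {n : ℕ} (a b : EReal) (A : ℝ → Matrix (Fin n) (Fin n) ℝ) : Prop :=
  ∀ i j : Fin n,
    AEMeasurable (fun t => A t i j) (volume.restrict (timeInterval a b)) ∧
    ∀ c d : ℝ, Icc c d ⊆ timeInterval a b →
      ∃ K : ℝ, ∀ᵐ t ∂(volume.restrict (Icc c d)), |A t i j| ≤ K

/-- `Φ` (with `Φ t t₀` for `Φ(t, t₀)`) is a transition matrix of `ż = A(t) z` on `(a, b)`:
for every `t₀ ∈ (a, b)`, the function `t ↦ Φ(t, t₀)` is locally absolutely continuous on `(a, b)`,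
satisfies `d/dt Φ(t, t₀) = A(t) Φ(t, t₀)` for almost every `t ∈ (a, b)`, and `Φ(t₀, t₀) = I`. -/
structure IsTransitionMatrix {n : ℕ} (a b : EReal) (A : ℝ → Matrix (Fin n) (Fin n) ℝ)
    (Φ : ℝ → ℝ → Matrix (Fin n) (Fin n) ℝ) : Prop where
  initial : ∀ t₀ ∈ timeInterval a b, Φ t₀ t₀ = 1
  locallyAC : ∀ t₀ ∈ timeInterval a b, ∀ i j : Fin n, ∀ c d : ℝ, c ≤ d →
    Icc c d ⊆ timeInterval a b → AbsolutelyContinuousOnInterval (fun t => Φ t t₀ i j) c d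
  ode : ∀ t₀ ∈ timeInterval a b, ∀ᵐ t ∂(volume.restrict (timeInterval a b)), ∀ i j : Fin n,
    HasDerivAt (fun s => Φ s t₀ i j) ((A t * Φ t t₀) i j) t

/-- `Φ̇ = A(t) Φ` is a totally positive differential system (TPDS) on `(a, b)`: it has a transition
matrix, and the transition matrix satisfies that `Φ(t, t₀)` is totally positive for all
`a < t₀ < t < b`. -/
def IsTPDS {n : ℕ} (a b : EReal) (A : ℝ → Matrix (Fin n) (Fin n) ℝ) : Prop :=
  (∃ Φ, IsTransitionMatrix a b A Φ) ∧
    ∀ Φ, IsTransitionMatrix a b A Φ →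
      ∀ t₀ ∈ timeInterval a b, ∀ t ∈ timeInterval a b, t₀ < t → (Φ t t₀).IsTotallyPositive

/-! ### Positivity of absolutely continuous solutions of cooperative linear systems -/

/-! Fix a column tuple `c`. The minors of `Φ(t, t₀)` with columns `c`, indexed by increasing row
tuples, solve a linear system whose matrix is the additive compound `Matrix.addCompound` of `A`.
Since `A` is tridiagonal, only moves of one row index to itself or to a neighbour contribute; such a
move either keeps the tuple increasing or repeats a row, so no sorting sign appears
(`Matrix.sum_det_updateRow_eq_addCompound`). The off-diagonal entries of the compound are therefore
nonnegative, and at least `δ` between tuples related by `minorAdj`, a relation that connects all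
tuples (`reflTransGen_minorAdj`).

In such a cooperative, irreducible system, nonnegative data with one positive component become
positive in every component at once (`pos_of_hasDerivAt_metzler`). At `t₀` the minors are those of
the identity: all nonnegative, and equal to 1 at row tuple `c`. Existence of the transition matrix
comes from the Peano–Baker series. -/

theorem AbsolutelyContinuousOnInterval.le_of_ae_hasDerivAt_nonneg {f : ℝ → ℝ} {c d : ℝ}
    (hcd : c ≤ d) (hf : AbsolutelyContinuousOnInterval f c d)
    (h : ∀ᵐ t, t ∈ Icc c d → ∃ f', 0 ≤ f' ∧ HasDerivAt f f' t) : f c ≤ f d := by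
  rw [← sub_nonneg, ← hf.integral_deriv_eq_sub]
  refine intervalIntegral.integral_nonneg_of_ae_restrict hcd ?_
  rw [Filter.EventuallyLE, ae_restrict_iff' measurableSet_Icc]
  filter_upwards [h] with t ht htm
  obtain ⟨f', h0, hd⟩ := ht htm
  simpa [hd.deriv] using h0

/-- A family that starts above `ε > 0` and is nondecreasing as long as all its members are
nonnegative stays above `ε`. -/
theorem le_of_ae_hasDerivAt_nonneg_of_nonneg {ι : Type*} [Finite ι] {w : ι → ℝ → ℝ} {c d ε : ℝ}
    (hε : 0 < ε) (hw : ∀ i, AbsolutelyContinuousOnInterval (w i) c d)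
    (h : ∀ᵐ t, t ∈ Icc c d → (∀ j, 0 ≤ w j t) → ∀ i, ∃ w', 0 ≤ w' ∧ HasDerivAt (w i) w' t)
    (h0 : ∀ i, ε ≤ w i c) : ∀ t ∈ Icc c d, ∀ i, ε ≤ w i t := by
  intro t₀ ht₀
  have hcd : c ≤ d := ht₀.1.trans ht₀.2
  have hcont : ∀ i, ContinuousOn (w i) (Icc c d) := fun i => by
    simpa [uIcc_of_le hcd] using (hw i).continuousOn
  -- Continuous induction: where all members are at least `ε` they stay positive a little longer,
  -- and there they are nondecreasing, so the bound `ε` itself is not eroded.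
  refine IsClosed.Icc_subset_of_forall_exists_gt (s := {t | ∀ i, ε ≤ w i t}) ?_ h0 ?_ ht₀
  · rw [inter_comm, show {t | ∀ i, ε ≤ w i t} = (fun t i => w i t) ⁻¹' Ici (fun _ => ε) from rfl]
    exact (continuousOn_pi.2 hcont).preimage_isClosed_of_isClosed isClosed_Icc isClosed_Ici
  · rintro x ⟨hx, hxc, hxd⟩ y hy
    have hev : ∀ᶠ t in nhdsWithin x (Icc c d), ∀ i, 0 < w i t := by
      rw [Filter.eventually_all]
      intro i
      exact (hcont i x ⟨hxc, hxd.le⟩).eventually (lt_mem_nhds (hε.trans_le (hx i)))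
    rw [eventually_nhdsWithin_iff, Metric.eventually_nhds_iff] at hev
    obtain ⟨r, hr, hball⟩ := hev
    obtain ⟨z, hz1, hz2⟩ := exists_between (lt_min (lt_min (a := x) (b := y) hy hxd) (lt_add_of_pos_right x hr))
    simp only [lt_min_iff] at hz2
    refine ⟨z, fun i => (hx i).trans ?_, hz1, hz2.1.1.le⟩
    refine ((hw i).mono ?_).le_of_ae_hasDerivAt_nonneg hz1.le ?_
    · rw [uIcc_of_le hz1.le, uIcc_of_le hcd]
      exact Icc_subset_Icc hxc hz2.1.2.le
    · filter_upwards [h] with t ht htm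
      have htm' : t ∈ Icc c d := ⟨hxc.trans htm.1, htm.2.trans hz2.1.2.le⟩
      refine ht htm' (fun j => (hball ?_ htm' j).le) i
      rw [Real.dist_eq, abs_lt]
      constructor <;> linarith [htm.1, htm.2]

section Cooperative

variable {ι : Type*} [Fintype ι] {c d K δ : ℝ}

/-- Adding `ε * exp (L * (t - c))` to each component, with `L` a bound for the row sums of `P`,
gives a family whose derivative dominates `P` applied to it. It is thus nondecreasing while
nonnegative; then `ε` is made small. -/
theorem nonneg_of_hasDerivAt_nonneg_matrix {z : ι → ℝ → ℝ} {P : ℝ → ι → ι → ℝ}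
    (hz : ∀ i, AbsolutelyContinuousOnInterval (z i) c d)
    (h : ∀ᵐ t, t ∈ Icc c d → ∀ i, HasDerivAt (z i) (∑ j, P t i j * z j t) t)
    (hP : ∀ᵐ t, t ∈ Icc c d → ∀ i j, 0 ≤ P t i j ∧ P t i j ≤ K)
    (h0 : ∀ i, 0 ≤ z i c) : ∀ t ∈ Icc c d, ∀ i, 0 ≤ z i t := by
  set L : ℝ := K * Fintype.card ι with hL
  have key : ∀ ε : ℝ, 0 < ε → ∀ t ∈ Icc c d, ∀ i, ε ≤ z i t + ε * Real.exp (L * (t - c)) := by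
    intro ε hε
    refine le_of_ae_hasDerivAt_nonneg_of_nonneg
      (w := fun i t => z i t + ε * Real.exp (L * (t - c))) hε (fun i => ?_) ?_ (fun i => ?_)
    · refine (hz i).fun_add (ContDiff.contDiffOn ?_).absolutelyContinuousOnInterval
      fun_prop
    · filter_upwards [h, hP] with t ht hPt htm hw i
      have he : HasDerivAt (fun t => ε * Real.exp (L * (t - c)))
          (ε * (Real.exp (L * (t - c)) * (L * 1))) t :=
        ((((hasDerivAt_id t).sub_const c).const_mul L).exp).const_mul ε
      refine ⟨_, ?_, (ht htm i).add he⟩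
      have hsum : ∑ j, P t i j ≤ L := by
        calc ∑ j, P t i j ≤ ∑ _j : ι, K := Finset.sum_le_sum fun j _ => (hPt htm i j).2
          _ = L := by simp [hL, mul_comm]
      have hpos : 0 ≤ ∑ j, P t i j * (z j t + ε * Real.exp (L * (t - c))) :=
        Finset.sum_nonneg fun j _ => mul_nonneg (hPt htm i j).1 (hw j)
      simp only [mul_add, Finset.sum_add_distrib, ← Finset.sum_mul] at hpos
      have := mul_le_mul_of_nonneg_right hsum
        (mul_nonneg hε.le (Real.exp_pos (L * (t - c))).le)
      linarith
    · simpa using h0 i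
  intro t ht i
  by_contra! hneg
  have hE := Real.exp_pos (L * (t - c))
  -- With this `ε` the perturbation at time `t` equals `-z i t / 2`, so `key` would bound the
  -- negative number `z i t / 2` below by `ε > 0`.
  have := key (-z i t / (2 * Real.exp (L * (t - c)))) (by apply div_pos <;> linarith) t ht i
  have h2 : -z i t / (2 * Real.exp (L * (t - c))) * Real.exp (L * (t - c)) = -z i t / 2 := by
    field_simp
  have h3 : 0 < -z i t / (2 * Real.exp (L * (t - c))) := by apply div_pos <;> linarith
  linarith

/-- All components are nonnegative, hence nondecreasing. Positivity then travels along the path from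
`i₀` back to `i`: if `adj i j` and `z j s > 0`, then `z i` grows after `s` at rate at least `δ * z j
s`. Each edge uses up part of the time interval, but an arbitrarily small part. -/
theorem pos_of_hasDerivAt_nonneg_matrix {z : ι → ℝ → ℝ} {P : ℝ → ι → ι → ℝ} {adj : ι → ι → Prop}
    (hδ : 0 < δ) (hz : ∀ i, AbsolutelyContinuousOnInterval (z i) c d)
    (h : ∀ᵐ t, t ∈ Icc c d → ∀ i, HasDerivAt (z i) (∑ j, P t i j * z j t) t)
    (hP : ∀ᵐ t, t ∈ Icc c d → ∀ i j, 0 ≤ P t i j ∧ P t i j ≤ K)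
    (hadj : ∀ᵐ t, t ∈ Icc c d → ∀ i j, adj i j → δ ≤ P t i j)
    (h0 : ∀ i, 0 ≤ z i c) {i₀ : ι} (hi₀ : 0 < z i₀ c) {i : ι}
    (hi : Relation.ReflTransGen adj i i₀) : ∀ t ∈ Ioc c d, 0 < z i t := by
  have hnn := nonneg_of_hasDerivAt_nonneg_matrix hz h hP h0
  have hmono : ∀ i, ∀ s t, c ≤ s → s ≤ t → t ≤ d → ∀ m : ℝ,
      (∀ᵐ τ, τ ∈ Icc s t → m ≤ ∑ j, P τ i j * z j τ) → m * (t - s) ≤ z i t - z i s := by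
    intro i s t hs hst ht m hm
    have hac : AbsolutelyContinuousOnInterval (fun τ => z i τ + -m * τ) s t := by
      refine ((hz i).mono ?_).fun_add (ContDiff.contDiffOn ?_).absolutelyContinuousOnInterval
      · rw [uIcc_of_le hst, uIcc_of_le (hs.trans (hst.trans ht))]
        exact Icc_subset_Icc hs ht
      · fun_prop
    have := hac.le_of_ae_hasDerivAt_nonneg hst ?_
    · linarith
    · filter_upwards [h, hm] with τ hτ hmτ hτm
      refine ⟨_, ?_, (hτ ⟨hs.trans hτm.1, hτm.2.trans ht⟩ i).add
        ((hasDerivAt_id τ).const_mul (-m))⟩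
      linarith [hmτ hτm]
  have hterm : ∀ᵐ τ, τ ∈ Icc c d → ∀ i j, 0 ≤ P τ i j * z j τ := by
    filter_upwards [hP] with τ hτ hτm i j
    exact mul_nonneg (hτ hτm i j).1 (hnn τ hτm j)
  have hmono0 : ∀ i, ∀ s t, c ≤ s → s ≤ t → t ≤ d → z i s ≤ z i t := by
    intro i s t hs hst ht
    have := hmono i s t hs hst ht 0 ?_
    · linarith
    · filter_upwards [hterm] with τ hτ hτm
      exact Finset.sum_nonneg fun j _ => hτ ⟨hs.trans hτm.1, hτm.2.trans ht⟩ i j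
  induction hi using Relation.ReflTransGen.head_induction_on with
  | refl => exact fun t ht => hi₀.trans_le (hmono0 _ c t le_rfl ht.1.le ht.2)
  | head hij _ ih =>
    rename_i i j _
    intro t ht
    obtain ⟨s, hs1, hs2⟩ := exists_between ht.1
    have hzs := ih s ⟨hs1, hs2.le.trans ht.2⟩
    have := hmono i s t hs1.le hs2.le ht.2 (δ * z j s) ?_
    · have h1 := hnn s ⟨hs1.le, hs2.le.trans ht.2⟩ i
      have h2 : 0 < δ * z j s * (t - s) := mul_pos (mul_pos hδ hzs) (sub_pos.2 hs2)
      linarith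
    · filter_upwards [hterm, hadj] with τ hτ haτ hτm
      have hm : τ ∈ Icc c d := ⟨hs1.le.trans hτm.1, hτm.2.trans ht.2⟩
      calc δ * z j s ≤ P τ i j * z j τ :=
            mul_le_mul (haτ hm i j hij) (hmono0 j s τ hs1.le hτm.1 hm.2) hzs.le
              (hδ.le.trans (haτ hm i j hij))
        _ ≤ ∑ j, P τ i j * z j τ :=
            Finset.single_le_sum (fun j _ => hτ hm i j) (Finset.mem_univ j)

/-- Solutions of a linear system whose coefficient matrix has nonnegative off-diagonal entries
and is uniformly irreducible become positive immediately. -/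
theorem pos_of_hasDerivAt_metzler {y : ι → ℝ → ℝ} {Q : ℝ → ι → ι → ℝ} {adj : ι → ι → Prop}
    (hδ : 0 < δ) (hcd : c < d) (hy : ∀ i, AbsolutelyContinuousOnInterval (y i) c d)
    (h : ∀ᵐ t, t ∈ Icc c d → ∀ i, HasDerivAt (y i) (∑ j, Q t i j * y j t) t)
    (hoff : ∀ᵐ t, t ∈ Icc c d → ∀ i j, i ≠ j → 0 ≤ Q t i j)
    (hbdd : ∀ᵐ t, t ∈ Icc c d → ∀ i j, |Q t i j| ≤ K)
    (hadj : ∀ᵐ t, t ∈ Icc c d → ∀ i j, adj i j → δ ≤ Q t i j)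
    (h0 : ∀ i, 0 ≤ y i c) {i₀ : ι} (hi₀ : 0 < y i₀ c) {i : ι}
    (hi : Relation.ReflTransGen adj i i₀) : 0 < y i d := by
  classical
  -- The factor `exp (K * t)` shifts the diagonal by `K`, which makes every coefficient nonnegative.
  have hK : ∀ᵐ t, t ∈ Icc c d → ∀ i j, 0 ≤ (Q t i j + if i = j then K else 0) ∧
      (Q t i j + if i = j then K else 0) ≤ K + K := by
    filter_upwards [hoff, hbdd] with t h1 h2 htm i j
    have h3 := abs_le.1 (h2 htm i j)
    have h4 := (abs_nonneg _).trans (h2 htm i j)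
    split_ifs with hij
    · constructor <;> linarith
    · have := h1 htm i j hij
      constructor <;> linarith
  have key := pos_of_hasDerivAt_nonneg_matrix (K := K + K) (c := c) (d := d) (i := i) (i₀ := i₀)
    (z := fun i t => Real.exp (K * t) * y i t)
    (P := fun t i j => Q t i j + if i = j then K else 0) (adj := adj) hδ (fun i => ?_) ?_ hK ?_
    (fun i => mul_nonneg (Real.exp_pos _).le (h0 i)) (mul_pos (Real.exp_pos _) hi₀) hi
    d ⟨hcd, le_rfl⟩
  · exact pos_of_mul_pos_right key (Real.exp_pos _).le
  · refine AbsolutelyContinuousOnInterval.fun_mul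
      (ContDiff.contDiffOn ?_).absolutelyContinuousOnInterval (hy i)
    fun_prop
  · filter_upwards [h] with t ht htm i
    have he : HasDerivAt (fun t => Real.exp (K * t)) (Real.exp (K * t) * (K * 1)) t :=
      ((hasDerivAt_id t).const_mul K).exp
    convert! he.mul (ht htm i) using 1
    simp only [add_mul, Finset.sum_add_distrib, ite_mul, zero_mul, Finset.sum_ite_eq,
      Finset.mem_univ, if_true, Finset.mul_sum]
    rw [add_comm]
    congr 1
    · ring
    · exact Finset.sum_congr rfl fun j _ => by ring
  · filter_upwards [hadj, hbdd] with t ht h2 htm i j hij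
    have h4 := (abs_nonneg _).trans (h2 htm i j)
    have := ht htm i j hij
    split_ifs <;> linarith

end Cooperative

/-! ### Minors of solutions of a tridiagonal system -/

theorem AbsolutelyContinuousOnInterval.fun_finsetSum {ι : Type*} {f : ι → ℝ → ℝ} {c d : ℝ}
    (s : Finset ι) (hf : ∀ i ∈ s, AbsolutelyContinuousOnInterval (f i) c d) :
    AbsolutelyContinuousOnInterval (fun t => ∑ i ∈ s, f i t) c d := by
  classical
  induction s using Finset.induction_on with
  | empty =>
    simpa using (contDiff_const (c := (0 : ℝ))).contDiffOn.absolutelyContinuousOnInterval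
  | insert a s ha ih =>
    simp only [Finset.sum_insert ha]
    exact (hf a (Finset.mem_insert_self a s)).fun_add
      (ih fun i hi => hf i (Finset.mem_insert_of_mem hi))

theorem AbsolutelyContinuousOnInterval.fun_finsetProd {ι : Type*} {f : ι → ℝ → ℝ} {c d : ℝ}
    (s : Finset ι) (hf : ∀ i ∈ s, AbsolutelyContinuousOnInterval (f i) c d) :
    AbsolutelyContinuousOnInterval (fun t => ∏ i ∈ s, f i t) c d := by
  classical
  induction s using Finset.induction_on with
  | empty =>
    simpa using (contDiff_const (c := (1 : ℝ))).contDiffOn.absolutelyContinuousOnInterval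
  | insert a s ha ih =>
    simp only [Finset.prod_insert ha]
    exact (hf a (Finset.mem_insert_self a s)).fun_mul
      (ih fun i hi => hf i (Finset.mem_insert_of_mem hi))

theorem AbsolutelyContinuousOnInterval.det {m : Type*} [Fintype m] [DecidableEq m]
    {M : ℝ → Matrix m m ℝ} {c d : ℝ}
    (hM : ∀ i j, AbsolutelyContinuousOnInterval (fun t => M t i j) c d) :
    AbsolutelyContinuousOnInterval (fun t => (M t).det) c d := by
  simp only [Matrix.det_apply']
  exact .fun_finsetSum _ fun σ _ => .const_mul _ (.fun_finsetProd _ fun i _ => hM _ _)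

theorem Matrix.hasDerivAt_det {m : Type*} [Fintype m] [DecidableEq m] {M : ℝ → Matrix m m ℝ}
    {M' : Matrix m m ℝ} {t : ℝ} (h : ∀ i j, HasDerivAt (fun s => M s i j) (M' i j) t) :
    HasDerivAt (fun s => (M s).det) (∑ i, ((M t).updateRow i (M' i)).det) t := by
  have key : HasDerivAt
      (fun s => ∑ σ : Equiv.Perm m, ((Equiv.Perm.sign σ : ℤ) : ℝ) * ∏ i, M s i (σ i))
      (∑ σ : Equiv.Perm m, ((Equiv.Perm.sign σ : ℤ) : ℝ) *
        ∑ i, (∏ j ∈ Finset.univ.erase i, M t j (σ j)) • M' i (σ i)) t :=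
    HasDerivAt.fun_sum fun σ _ => (HasDerivAt.fun_finsetProd fun i _ => h i (σ i)).const_mul _
  -- The Leibniz formula with the permutation acting on columns, so that each factor belongs to one
  -- row.
  have hdet : ∀ N : Matrix m m ℝ,
      N.det = ∑ σ : Equiv.Perm m, ((Equiv.Perm.sign σ : ℤ) : ℝ) * ∏ i, N i (σ i) := fun N => by
    rw [← Matrix.det_transpose, Matrix.det_apply']
    rfl
  simp only [hdet]
  rw [Finset.sum_comm]
  convert! key using 3 with σ
  rw [Finset.mul_sum]
  refine Finset.sum_congr rfl fun i _ => ?_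
  rw [← Finset.mul_prod_erase _ _ (Finset.mem_univ i), Matrix.updateRow_self, smul_eq_mul,
    mul_comm (M' i (σ i))]
  congr 2
  exact Finset.prod_congr rfl fun j hj => by
    rw [Matrix.updateRow_ne (Finset.ne_of_mem_erase hj)]

theorem Matrix.det_updateRow_finsetSum {m ι : Type*} [Fintype m] [DecidableEq m]
    (M : Matrix m m ℝ) (i : m) (s : Finset ι) (v : ι → m → ℝ) :
    (M.updateRow i (∑ j ∈ s, v j)).det = ∑ j ∈ s, (M.updateRow i (v j)).det :=
  (Matrix.detRowAlternating (R := ℝ) (n := m)).toMultilinearMap.map_update_sum s i v M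

section Minors

variable {n k : ℕ}

/-- The entries of the additive compound of a tridiagonal matrix, indexed by increasing tuples. -/
noncomputable def Matrix.addCompound (B : Matrix (Fin n) (Fin n) ℝ) (r r' : Fin k ↪o Fin n) : ℝ :=
  ∑ i, ∑ j, if Function.update r i j = r' then B (r i) j else 0

/-- Two increasing tuples are adjacent if they differ by one in exactly one position. -/
def minorAdj (r r' : Fin k ↪o Fin n) : Prop :=
  ∃ (i : Fin k) (j : Fin n), |((r i : Fin n) : ℤ) - (j : ℤ)| = 1 ∧ Function.update r i j = r'

/-- An entry moved by at most one cannot jump over its neighbours; it can only collide with one. -/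
theorem strictMono_update_of_injective (r : Fin k ↪o Fin n) {i : Fin k} {j : Fin n}
    (hj : |((r i : Fin n) : ℤ) - (j : ℤ)| ≤ 1) (hinj : Function.Injective (Function.update r i j)) :
    StrictMono (Function.update r i j) := by
  intro p q hpq
  have hne : Function.update r i j p ≠ Function.update r i j q := fun h => hpq.ne (hinj h)
  have hr := r.strictMono hpq
  rw [abs_le] at hj
  simp only [Function.update_apply, Fin.lt_def, ne_eq, Fin.ext_iff] at *
  split_ifs at * with h1 h2 h2
  · omega
  · rw [Fin.ext h1] at hr; omega
  · rw [Fin.ext h2] at hr; omega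
  · omega

/-- Expand row `r i` of `B * N` in the rows of `N`. The resulting tuple is increasing and
contributes to the compound, or has a repeated row and zero determinant, or comes with a coefficient
outside the band of `B`. -/
theorem Matrix.sum_det_updateRow_eq_addCompound {B : Matrix (Fin n) (Fin n) ℝ} (hB : B.IsTridiag)
    (N : Matrix (Fin n) (Fin k) ℝ) (r : Fin k ↪o Fin n) :
    ∑ i, ((N.submatrix r id).updateRow i ((B * N) (r i))).det =
      ∑ r', B.addCompound r r' * (N.submatrix r' id).det := by
  have hrow : ∀ i, (B * N) (r i) = ∑ j, B (r i) j • N j := fun i => by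
    ext l; simp [Matrix.mul_apply]
  have hupd : ∀ i j, (N.submatrix r id).updateRow i (N j) =
      N.submatrix (Function.update r i j) id := fun i j => by
    ext p q
    by_cases hp : p = i <;> simp [Matrix.updateRow_apply, hp]
  simp only [hrow, Matrix.det_updateRow_finsetSum, Matrix.det_updateRow_smul, hupd,
    Matrix.addCompound, Finset.sum_mul]
  rw [Finset.sum_comm (s := Finset.univ (α := Fin k ↪o Fin n))]
  refine Finset.sum_congr rfl fun i _ => ?_
  rw [Finset.sum_comm (s := Finset.univ (α := Fin k ↪o Fin n))]
  refine Finset.sum_congr rfl fun j _ => ?_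
  by_cases hs : StrictMono (Function.update r i j)
  · rw [Finset.sum_eq_single (OrderEmbedding.ofStrictMono _ hs)]
    · simp
    · intro r' _ hr'
      rw [if_neg, zero_mul]
      intro h
      exact hr' (DFunLike.coe_injective (by simp [h]))
    · simp
  · rw [Finset.sum_eq_zero]
    · by_cases hj : |((r i : Fin n) : ℤ) - (j : ℤ)| ≤ 1
      · have hinj := mt (strictMono_update_of_injective r hj) hs
        simp only [Function.Injective, not_forall] at hinj
        obtain ⟨p, q, hpq, hne⟩ := hinj
        rw [Matrix.det_zero_of_row_eq hne, mul_zero]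
        ext l
        simp [hpq]
      · rw [hB _ _ (not_le.1 hj), zero_mul]
    · intro r' _
      rw [if_neg, zero_mul]
      exact fun h => hs (h ▸ r'.strictMono)

theorem Matrix.IsMPlus.nonneg {B : Matrix (Fin n) (Fin n) ℝ} (hB : B.IsMPlus) {i j : Fin n}
    (hij : i ≠ j) : 0 ≤ B i j := by
  have h : (i : ℤ) ≠ j := fun h => hij (Fin.ext (by exact_mod_cast h))
  rcases lt_or_ge 1 |(i : ℤ) - (j : ℤ)| with h1 | h1
  · exact (hB.1 i j h1).ge
  · exact (hB.2 i j (le_antisymm h1 (Int.one_le_abs (sub_ne_zero.2 h)))).le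

/-- A diagonal entry of `B`, whose sign is unknown, would leave `r` unchanged, which `r ≠ r'`
excludes. -/
theorem Matrix.IsMPlus.addCompound_summand_nonneg {B : Matrix (Fin n) (Fin n) ℝ} (hB : B.IsMPlus)
    {r r' : Fin k ↪o Fin n} (hr : r ≠ r') (i : Fin k) (j : Fin n) :
    0 ≤ if Function.update r i j = r' then B (r i) j else 0 := by
  split_ifs with h
  · refine hB.nonneg fun hj => hr (DFunLike.coe_injective ?_)
    rw [← h, ← hj, Function.update_eq_self]
  · exact le_rfl

theorem Matrix.IsMPlus.addCompound_nonneg {B : Matrix (Fin n) (Fin n) ℝ} (hB : B.IsMPlus)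
    {r r' : Fin k ↪o Fin n} (hr : r ≠ r') : 0 ≤ B.addCompound r r' :=
  Finset.sum_nonneg fun i _ => Finset.sum_nonneg fun j _ => hB.addCompound_summand_nonneg hr i j

theorem minorAdj.ne {r r' : Fin k ↪o Fin n} (h : minorAdj r r') : r ≠ r' := by
  rintro rfl
  obtain ⟨i, j, hj, h⟩ := h
  have := congrFun h i
  rw [Function.update_self] at this
  simp [this] at hj

theorem minorAdj.symm {r r' : Fin k ↪o Fin n} (h : minorAdj r r') : minorAdj r' r := by
  obtain ⟨i, j, hj, h⟩ := h
  refine ⟨i, r i, ?_, ?_⟩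
  · rw [← h, Function.update_self, abs_sub_comm, hj]
  · rw [← h, Function.update_idem, Function.update_eq_self]

theorem Matrix.IsMPlus.le_addCompound {B : Matrix (Fin n) (Fin n) ℝ} (hB : B.IsMPlus) {δ : ℝ}
    (hδ : ∀ i j : Fin n, |(i : ℤ) - (j : ℤ)| = 1 → δ ≤ B i j)
    {r r' : Fin k ↪o Fin n} (hr : minorAdj r r') : δ ≤ B.addCompound r r' := by
  have hne := hr.ne
  obtain ⟨i, j, hj, h⟩ := hr
  have hterm := hB.addCompound_summand_nonneg hne
  calc δ ≤ if Function.update r i j = r' then B (r i) j else 0 := by simpa [h] using hδ _ _ hj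
    _ ≤ ∑ j, if Function.update r i j = r' then B (r i) j else 0 :=
      Finset.single_le_sum (f := fun j => if Function.update r i j = r' then B (r i) j else 0)
        (fun j _ => hterm i j) (Finset.mem_univ j)
    _ ≤ B.addCompound r r' :=
      Finset.single_le_sum
        (f := fun i => ∑ j, if Function.update r i j = r' then B (r i) j else 0)
        (fun i _ => Finset.sum_nonneg fun j _ => hterm i j) (Finset.mem_univ i)

theorem Matrix.abs_addCompound_le {B : Matrix (Fin n) (Fin n) ℝ} {K : ℝ}
    (hK : ∀ i j, |B i j| ≤ K) (r r' : Fin k ↪o Fin n) : |B.addCompound r r'| ≤ k * (n * K) := by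
  calc |B.addCompound r r'| ≤ ∑ _i : Fin k, ∑ _j : Fin n, K := by
        refine (Finset.abs_sum_le_sum_abs _ _).trans (Finset.sum_le_sum fun i _ => ?_)
        refine (Finset.abs_sum_le_sum_abs _ _).trans (Finset.sum_le_sum fun j _ => ?_)
        split_ifs
        · exact hK _ _
        · simpa using (abs_nonneg _).trans (hK (r i) j)
    _ = k * (n * K) := by simp

/-- Lowering the first entry that differs from its position by one keeps the tuple increasing and
decreases the sum of its entries, so the descent ends at the initial tuple. -/
theorem reflTransGen_minorAdj_castLEOrderEmb (hkn : k ≤ n) (r : Fin k ↪o Fin n) :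
    Relation.ReflTransGen minorAdj r (Fin.castLEOrderEmb hkn) := by
  induction hs : ∑ i, (r i : ℕ) using Nat.strong_induction_on generalizing r with
  | _ s ih =>
  by_cases hall : ∀ i, (r i : ℕ) = i
  · have : r = Fin.castLEOrderEmb hkn := by
      ext i; simp [hall]
    rw [this]
  · have hex : ∃ m : ℕ, ∃ h : m < k, (r ⟨m, h⟩ : ℕ) ≠ m := by
      push Not at hall
      obtain ⟨i, hi⟩ := hall
      exact ⟨i, i.2, hi⟩
    classical
    obtain ⟨hmk, hm⟩ := Nat.find_spec hex
    have hmin : ∀ p (hp : p < k), p < Nat.find hex → (r ⟨p, hp⟩ : ℕ) = p := fun p hp hlt => by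
      have := Nat.find_min hex hlt
      push Not at this
      exact this hp
    set m := Nat.find hex
    set i : Fin k := ⟨m, hmk⟩ with hi
    -- If `r i < m`, position `r i` would already hold the value `r i`, against injectivity.
    have hgt : m < r i := by
      rcases lt_or_gt_of_ne hm with hlt | hgt
      · have h1 := hmin (r i) (hlt.trans hmk) hlt
        have h2 : (⟨r i, hlt.trans hmk⟩ : Fin k) = i := r.injective (Fin.ext h1)
        rw [Fin.ext_iff] at h2
        exact absurd h2 hm
      · exact hgt
    have hlt : (r i : ℕ) - 1 < n := by have := (r i).2; omega
    set j : Fin n := ⟨(r i : ℕ) - 1, hlt⟩ with hj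
    have hmono : StrictMono (Function.update r i j) := by
      intro p q hpq
      have hr := r.strictMono hpq
      have hp := hmin p p.2
      simp only [Function.update_apply, Fin.lt_def, Fin.ext_iff] at *
      split_ifs with h1 h2 h2
      · omega
      · have : p = i := Fin.ext h1
        subst this
        simp only [hj]
        omega
      · have := hp (by omega)
        simp only [hj]
        simp only [Fin.eta] at this
        omega
      · exact hr
    have hadj : minorAdj r (OrderEmbedding.ofStrictMono _ hmono) := by
      refine ⟨i, j, ?_, by simp⟩
      have : ((r i : ℕ) : ℤ) - ((j : ℕ) : ℤ) = 1 := by simp only [hj]; omega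
      rw [this, abs_one]
    refine .head hadj (ih _ ?_ _ rfl)
    rw [← hs]
    refine Finset.sum_lt_sum (fun p _ => ?_) ⟨i, Finset.mem_univ i, ?_⟩
    · simp only [OrderEmbedding.coe_ofStrictMono, Function.update_apply]
      split_ifs with h
      · simp only [h, hj]; omega
      · exact le_rfl
    · simp only [OrderEmbedding.coe_ofStrictMono, Function.update_self, hj]; omega

theorem reflTransGen_minorAdj (r r' : Fin k ↪o Fin n) : Relation.ReflTransGen minorAdj r r' := by
  have hkn : k ≤ n := by simpa using Fintype.card_le_of_injective r r.injective
  refine (reflTransGen_minorAdj_castLEOrderEmb hkn r).trans ?_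
  have := reflTransGen_minorAdj_castLEOrderEmb hkn r'
  have hsymm : Std.Symm (minorAdj (k := k) (n := n)) := ⟨fun _ _ h => h.symm⟩
  exact Relation.ReflTransGen.stdSymm.symm _ _ this

theorem det_one_submatrix_nonneg (r c : Fin k ↪o Fin n) :
    0 ≤ ((1 : Matrix (Fin n) (Fin n) ℝ).submatrix r c).det := by
  by_cases hrc : r = c
  · subst hrc
    rw [Matrix.submatrix_one r r.injective, Matrix.det_one]
    exact zero_le_one
  -- Distinct increasing tuples of equal length have ranges of equal size, neither inside the other;
  -- an index of `r` missing from `c` gives a zero row.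
  · have hex : ∃ p, ∀ q, r p ≠ c q := by
      by_contra! hall
      refine hrc (DFunLike.coe_injective ((r.strictMono.range_inj c.strictMono).1 ?_))
      refine Set.eq_of_subset_of_card_le (range_subset_iff.2 fun p => ?_) ?_
      · obtain ⟨q, hq⟩ := hall p
        exact ⟨q, hq.symm⟩
      · simp [Set.card_range_of_injective r.injective, Set.card_range_of_injective c.injective]
    obtain ⟨p, hp⟩ := hex
    rw [Matrix.det_eq_zero_of_row_eq_zero p fun q => by simp [hp q]]

end Minors

/-! ### Existence of transition matrices -/

/-- The terms of the Peano–Baker series solving `ẋ = A(t) x`, `x(t₀) = v`. -/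
noncomputable def peanoBaker {ι : Type*} [Fintype ι] (A : ℝ → Matrix ι ι ℝ) (t₀ : ℝ) (v : ι → ℝ) :
    ℕ → ℝ → ι → ℝ
  | 0 => fun _ => v
  | k + 1 => fun t i => ∫ s in t₀..t, ∑ j, A s i j * peanoBaker A t₀ v k s j

section PeanoBaker

variable {ι : Type*} [Fintype ι] {A : ℝ → Matrix ι ι ℝ} {t₀ c d K V : ℝ} {v : ι → ℝ}

theorem intervalIntegrable_sum_mul {x : ι → ℝ → ℝ} {i : ι}
    (hA : ∀ i j, IntervalIntegrable (fun t => A t i j) volume c d)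
    (hx : ∀ j, ContinuousOn (x j) (uIcc c d)) :
    IntervalIntegrable (fun s => ∑ j, A s i j * x j s) volume c d := by
  simpa only [Finset.sum_fn] using IntervalIntegrable.sum Finset.univ
    (f := fun j s => A s i j * x j s) fun j _ => (hA i j).mul_continuousOn (hx j)

theorem continuousOn_peanoBaker (hA : ∀ i j, IntervalIntegrable (fun t => A t i j) volume c d)
    (ht₀ : t₀ ∈ uIcc c d) (k : ℕ) (i : ι) :
    ContinuousOn (fun t => peanoBaker A t₀ v k t i) (uIcc c d) := by
  induction k generalizing i with
  | zero => exact continuousOn_const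
  | succ k ih =>
    exact ((intervalIntegrable_sum_mul hA ih).absolutelyContinuousOnInterval_intervalIntegral
      ht₀).continuousOn

theorem abs_sum_mul_le {B : Matrix ι ι ℝ} {x : ι → ℝ} {M : ℝ} (hB : ∀ i j, |B i j| ≤ K)
    (hx : ∀ j, |x j| ≤ M) (i : ι) : |∑ j, B i j * x j| ≤ Fintype.card ι * K * M := by
  calc |∑ j, B i j * x j| ≤ ∑ j, |B i j * x j| := Finset.abs_sum_le_sum_abs _ _
    _ ≤ ∑ _j : ι, K * M := Finset.sum_le_sum fun j _ => by
        rw [abs_mul]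
        exact mul_le_mul (hB i j) (hx j) (abs_nonneg _) ((abs_nonneg _).trans (hB i j))
    _ = Fintype.card ι * K * M := by simp [mul_assoc]

/-- Each iteration integrates `|s - t₀| ^ k`, and the resulting factors `1 / (k + 1)` build the
factorial. -/
theorem abs_peanoBaker_le (hAK : ∀ᵐ t, t ∈ uIcc c d → ∀ i j, |A t i j| ≤ K)
    (hK : 0 ≤ K) (ht₀ : t₀ ∈ uIcc c d) (hv : ∀ i, |v i| ≤ V) (k : ℕ) {t : ℝ} (ht : t ∈ uIcc c d) (i : ι) :
    |peanoBaker A t₀ v k t i| ≤ V * ((Fintype.card ι * K * |t - t₀|) ^ k / k.factorial) := by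
  induction k generalizing t i with
  | zero => simpa [peanoBaker] using hv i
  | succ k ih =>
    set L : ℝ := Fintype.card ι * K
    have hsub : uIoc t₀ t ⊆ uIcc c d := uIoc_subset_uIcc.trans (uIcc_subset_uIcc ht₀ ht)
    have hbound : ∀ᵐ s ∂volume.restrict (uIoc t₀ t),
        ‖∑ j, A s i j * peanoBaker A t₀ v k s j‖ ≤
          L * (V * (L ^ k / k.factorial)) * |s - t₀| ^ k := by
      rw [ae_restrict_iff' measurableSet_uIoc]
      filter_upwards [hAK] with s hs hst
      refine (abs_sum_mul_le (hs (hsub hst)) (fun j => ih (hsub hst) j) i).trans_eq ?_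
      rw [mul_pow]
      ring
    have hint : IntervalIntegrable (fun s => L * (V * (L ^ k / k.factorial)) * |s - t₀| ^ k)
        volume t₀ t := Continuous.intervalIntegrable (by fun_prop) _ _
    have h1 := intervalIntegral.norm_integral_le_abs_of_norm_le hbound hint
    rw [intervalIntegral.integral_const_mul, abs_mul, intervalIntegral.abs_intervalIntegral_eq,
      integral_pow_abs_sub_uIoc] at h1
    refine h1.trans_eq ?_
    have hV : 0 ≤ V := (abs_nonneg _).trans (hv i)
    have hL : 0 ≤ L := by positivity
    clear_value L
    rw [abs_of_nonneg (a := L * _) (by positivity), abs_of_nonneg (by positivity), mul_pow L, pow_succ L,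
      Nat.factorial_succ]
    push_cast
    field_simp

theorem summable_peanoBaker_bound (V L : ℝ) :
    Summable fun k : ℕ => V * (L ^ k / k.factorial) :=
  (Real.summable_pow_div_factorial L).mul_left V

/-- The sum of the Peano–Baker series solves the integral equation. -/
theorem tsum_peanoBaker_eq (hA : ∀ i j, IntervalIntegrable (fun t => A t i j) volume c d)
    (hAK : ∀ᵐ t, t ∈ uIcc c d → ∀ i j, |A t i j| ≤ K) (hK : 0 ≤ K)
    (ht₀ : t₀ ∈ uIcc c d) :
    (∀ i, ContinuousOn (fun t => ∑' k, peanoBaker A t₀ v k t i) (uIcc c d)) ∧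
    ∀ t ∈ uIcc c d, ∀ i, ∑' k, peanoBaker A t₀ v k t i =
      v i + ∫ s in t₀..t, ∑ j, A s i j * ∑' k, peanoBaker A t₀ v k s j := by
  obtain ⟨V, hV⟩ : ∃ V, ∀ i, |v i| ≤ V :=
    ⟨∑ i, |v i|, fun i => Finset.single_le_sum (fun j _ => abs_nonneg (v j)) (Finset.mem_univ i)⟩
  set L : ℝ := Fintype.card ι * K * |d - c| with hL
  set M : ℕ → ℝ := fun k => V * (L ^ k / k.factorial) with hM
  have hMsum : Summable M := summable_peanoBaker_bound V L
  have hle : ∀ k, ∀ t ∈ uIcc c d, ∀ i, |peanoBaker A t₀ v k t i| ≤ M k := by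
    intro k t ht i
    refine (abs_peanoBaker_le hAK hK ht₀ hV k ht i).trans ?_
    have h0 : 0 ≤ V := (abs_nonneg _).trans (hV i)
    have h1 : |t - t₀| ≤ |d - c| := abs_sub_le_of_uIcc_subset_uIcc (uIcc_subset_uIcc ht₀ ht)
    simp only [hM, hL]
    gcongr
  have hsum : ∀ t ∈ uIcc c d, ∀ i, Summable fun k => peanoBaker A t₀ v k t i := fun t ht i =>
    .of_norm_bounded hMsum fun k => hle k t ht i
  have hcont : ∀ i, ContinuousOn (fun t => ∑' k, peanoBaker A t₀ v k t i) (uIcc c d) := fun i =>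
    continuousOn_tsum (fun k => continuousOn_peanoBaker hA ht₀ k i) hMsum
      fun k t ht => hle k t ht i
  refine ⟨hcont, fun t ht i => ?_⟩
  have hsub : uIoc t₀ t ⊆ uIcc c d := uIoc_subset_uIcc.trans (uIcc_subset_uIcc ht₀ ht)
  have hsub' : uIcc t₀ t ⊆ uIcc c d := uIcc_subset_uIcc ht₀ ht
  have key := intervalIntegral.hasSum_integral_of_dominated_convergence (μ := volume)
    (a := t₀) (b := t) (F := fun k s => ∑ j, A s i j * peanoBaker A t₀ v k s j)
    (f := fun s => ∑ j, A s i j * ∑' k, peanoBaker A t₀ v k s j)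
    (fun k _ => Fintype.card ι * K * M k) (fun k => ?_) (fun k => ?_)
    (.of_forall fun s _ => hMsum.mul_left _) intervalIntegrable_const
    (.of_forall fun s hs => hasSum_sum fun j _ => (hsum s (hsub hs) j).hasSum.mul_left _)
  -- By definition the `k`-th integral is the term of index `k + 1`, so only the zeroth term `v` is
  -- split off.
  · rw [(hsum t ht i).tsum_eq_zero_add, ← key.tsum_eq]
    rfl
  · exact (intervalIntegrable_iff.1 ((intervalIntegrable_sum_mul hA fun j =>
      continuousOn_peanoBaker hA ht₀ k j).mono_set hsub')).aestronglyMeasurable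
  · filter_upwards [hAK] with s hs hst
    exact abs_sum_mul_le (hs (hsub hst)) (fun j => hle k s (hsub hst) j) i

end PeanoBaker

/-! ### From compact subintervals to the whole interval `(a, b)` -/

theorem ordConnected_timeInterval (a b : EReal) : (timeInterval a b).OrdConnected :=
  ⟨fun _ hx _ hy _ hz => ⟨hx.1.trans_le (EReal.coe_le_coe_iff.2 hz.1),
    (EReal.coe_le_coe_iff.2 hz.2).trans_lt hy.2⟩⟩

theorem isOpen_timeInterval (a b : EReal) : IsOpen (timeInterval a b) :=
  isOpen_Ioo.preimage continuous_coe_real_ereal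

/-- Countably many compact intervals with rational endpoints, all containing `t₀`, cover `(a, b)`.
-/
theorem ae_timeInterval_of_forall_Icc {a b : EReal} {p : ℝ → Prop} {t₀ : ℝ}
    (ht₀ : t₀ ∈ timeInterval a b)
    (h : ∀ c d, Icc c d ⊆ timeInterval a b → t₀ ∈ Icc c d → ∀ᵐ t, t ∈ Icc c d → p t) :
    ∀ᵐ t ∂volume.restrict (timeInterval a b), p t := by
  rw [ae_restrict_iff' (isOpen_timeInterval a b).measurableSet]
  have hall : ∀ᵐ t, ∀ q : ℚ × ℚ, Icc (q.1 : ℝ) q.2 ⊆ timeInterval a b →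
      t₀ ∈ Icc (q.1 : ℝ) q.2 → t ∈ Icc (q.1 : ℝ) q.2 → p t := by
    rw [ae_all_iff]
    intro q
    by_cases h1 : Icc (q.1 : ℝ) q.2 ⊆ timeInterval a b
    · by_cases h2 : t₀ ∈ Icc (q.1 : ℝ) q.2
      · filter_upwards [h _ _ h1 h2] with t ht _ _ using ht
      · exact .of_forall fun t _ h => absurd h h2
    · exact .of_forall fun t h => absurd h h1
  filter_upwards [hall] with t ht htm
  have hmem : ∀ x ∈ timeInterval a b,
      ∃ p q : ℚ, (p : ℝ) ∈ timeInterval a b ∧ (q : ℝ) ∈ timeInterval a b ∧ (p : ℝ) < x ∧ x < q := by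
    intro x hx
    obtain ⟨l, u, hlu, hsub⟩ :=
      mem_nhds_iff_exists_Ioo_subset.1 ((isOpen_timeInterval a b).mem_nhds hx)
    obtain ⟨p, hp1, hp2⟩ := exists_rat_btwn hlu.1
    obtain ⟨q, hq1, hq2⟩ := exists_rat_btwn hlu.2
    exact ⟨p, q, hsub ⟨hp1, hp2.trans hlu.2⟩, hsub ⟨hlu.1.trans hq1, hq2⟩, hp2, hq1⟩
  have hmin : min t t₀ ∈ timeInterval a b := by rcases min_choice t t₀ with h | h <;> rwa [h]
  have hmax : max t t₀ ∈ timeInterval a b := by rcases max_choice t t₀ with h | h <;> rwa [h]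
  obtain ⟨p, -, hp, -, hp1, -⟩ := hmem _ hmin
  obtain ⟨-, q, -, hq, -, hq1⟩ := hmem _ hmax
  rw [lt_min_iff] at hp1
  rw [max_lt_iff] at hq1
  exact ht (p, q) ((ordConnected_timeInterval a b).out hp hq) ⟨hp1.2.le, hq1.2.le⟩
    ⟨hp1.1.le, hq1.1.le⟩

section

variable {n : ℕ} {a b : EReal} {A : ℝ → Matrix (Fin n) (Fin n) ℝ}

theorem IsLocEssBddMeas.exists_bound (hA : IsLocEssBddMeas a b A) {c d : ℝ}
    (hcd : Icc c d ⊆ timeInterval a b) :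
    ∃ K, 0 ≤ K ∧ ∀ᵐ t, t ∈ Icc c d → ∀ i j, |A t i j| ≤ K := by
  choose K hK using fun i j => (hA i j).2 c d hcd
  refine ⟨∑ i, ∑ j, |K i j|,
    Finset.sum_nonneg fun i _ => Finset.sum_nonneg fun j _ => abs_nonneg _, ?_⟩
  have : ∀ᵐ t, ∀ i j, t ∈ Icc c d → |A t i j| ≤ K i j := by
    rw [ae_all_iff]; intro i
    rw [ae_all_iff]; intro j
    exact (ae_restrict_iff' measurableSet_Icc).1 (hK i j)
  filter_upwards [this] with t ht htm i j
  calc |A t i j| ≤ |K i j| := (ht i j htm).trans (le_abs_self _)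
    _ ≤ ∑ j, |K i j| := Finset.single_le_sum (f := fun j => |K i j|)
        (fun j _ => abs_nonneg _) (Finset.mem_univ j)
    _ ≤ _ := Finset.single_le_sum (f := fun i => ∑ j, |K i j|)
        (fun i _ => Finset.sum_nonneg fun j _ => abs_nonneg _) (Finset.mem_univ i)

theorem IsLocEssBddMeas.intervalIntegrable (hA : IsLocEssBddMeas a b A) {c d : ℝ} (hle : c ≤ d)
    (hcd : Icc c d ⊆ timeInterval a b) (i j : Fin n) :
    IntervalIntegrable (fun t => A t i j) volume c d := by
  obtain ⟨K, -, hK⟩ := hA.exists_bound hcd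
  rw [intervalIntegrable_iff_integrableOn_Icc_of_le hle]
  refine Integrable.of_bound
    ((hA i j).1.mono_measure (Measure.restrict_mono hcd le_rfl)).aestronglyMeasurable K ?_
  rw [ae_restrict_iff' measurableSet_Icc]
  filter_upwards [hK] with t ht htm using ht htm i j

theorem IsLocEssBddMeas.exists_solution (hA : IsLocEssBddMeas a b A) {t₀ : ℝ}
    (ht₀ : t₀ ∈ timeInterval a b) (v : Fin n → ℝ) :
    ∃ x : Fin n → ℝ → ℝ, (∀ i, x i t₀ = v i) ∧
      (∀ i c d, c ≤ d → Icc c d ⊆ timeInterval a b →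
        AbsolutelyContinuousOnInterval (x i) c d) ∧
      ∀ᵐ t ∂volume.restrict (timeInterval a b), ∀ i,
        HasDerivAt (x i) (∑ j, A t i j * x j t) t := by
  set X : Fin n → ℝ → ℝ := fun i t => ∑' k, peanoBaker A t₀ v k t i with hX
  have hXc : ∀ c d, Icc c d ⊆ timeInterval a b → t₀ ∈ Icc c d →
      (∀ i, IntervalIntegrable (fun s => ∑ j, A s i j * X j s) volume c d) ∧
      ∀ t ∈ Icc c d, ∀ i, X i t = v i + ∫ s in t₀..t, ∑ j, A s i j * X j s := by
    intro c d hcd ht₀'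
    have hle := ht₀'.1.trans ht₀'.2
    obtain ⟨K, hK0, hK⟩ := hA.exists_bound hcd
    rw [← uIcc_of_le hle] at hK ht₀' ⊢
    have hint := hA.intervalIntegrable hle hcd
    obtain ⟨h1, h2⟩ := tsum_peanoBaker_eq (v := v) hint hK hK0 ht₀'
    exact ⟨fun i => intervalIntegrable_sum_mul hint h1, h2⟩
  -- Taking the right side of the integral equation instead of the series `X` yields absolute
  -- continuity and the derivative directly; the equation is then needed only pointwise, to identify
  -- the two.
  refine ⟨fun i t => v i + ∫ s in t₀..t, ∑ j, A s i j * X j s, fun i => by simp, ?_, ?_⟩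
  · intro i c d hle hcd
    have hsub : Icc (min c t₀) (max d t₀) ⊆ timeInterval a b := by
      refine (ordConnected_timeInterval a b).out ?_ ?_
      · rcases min_choice c t₀ with h | h <;> rw [h]
        exacts [hcd ⟨le_rfl, hle⟩, ht₀]
      · rcases max_choice d t₀ with h | h <;> rw [h]
        exacts [hcd ⟨hle, le_rfl⟩, ht₀]
    have hm : t₀ ∈ Icc (min c t₀) (max d t₀) := ⟨min_le_right _ _, le_max_right _ _⟩
    have hle' := hm.1.trans hm.2
    have hac := ((hXc _ _ hsub hm).1 i).absolutelyContinuousOnInterval_intervalIntegral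
      (c := t₀) (by rwa [uIcc_of_le hle'])
    refine AbsolutelyContinuousOnInterval.fun_add
      (contDiff_const.contDiffOn).absolutelyContinuousOnInterval (hac.mono ?_)
    rw [uIcc_of_le hle', uIcc_of_le hle]
    exact Icc_subset_Icc (min_le_left _ _) (le_max_left _ _)
  · refine ae_timeInterval_of_forall_Icc ht₀ fun c d hcd hm => ?_
    obtain ⟨h1, h2⟩ := hXc c d hcd hm
    have hd : ∀ᵐ t, ∀ i, t ∈ uIcc c d → ∀ e ∈ uIcc c d,
        HasDerivAt (fun t => ∫ s in e..t, ∑ j, A s i j * X j s) (∑ j, A t i j * X j t) t :=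
      ae_all_iff.2 fun i => (h1 i).ae_hasDerivAt_integral
    rw [uIcc_of_le (hm.1.trans hm.2)] at hd
    filter_upwards [hd] with t ht htm i
    simp only [← h2 t htm]
    exact (ht i htm t₀ hm).const_add (v i)

theorem IsLocEssBddMeas.exists_isTransitionMatrix (hA : IsLocEssBddMeas a b A) :
    ∃ Φ, IsTransitionMatrix a b A Φ := by
  have h : ∀ t₀ (j : Fin n), ∃ x : Fin n → ℝ → ℝ, t₀ ∈ timeInterval a b →
      (∀ i, x i t₀ = (1 : Matrix (Fin n) (Fin n) ℝ) i j) ∧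
      (∀ i c d, c ≤ d → Icc c d ⊆ timeInterval a b →
        AbsolutelyContinuousOnInterval (x i) c d) ∧
      ∀ᵐ t ∂volume.restrict (timeInterval a b), ∀ i,
        HasDerivAt (x i) (∑ j, A t i j * x j t) t := by
    intro t₀ j
    by_cases ht₀ : t₀ ∈ timeInterval a b
    · obtain ⟨x, hx⟩ := hA.exists_solution ht₀ fun i => (1 : Matrix (Fin n) (Fin n) ℝ) i j
      exact ⟨x, fun _ => hx⟩
    · exact ⟨0, fun h => absurd h ht₀⟩
  choose x hx using h
  refine ⟨fun t t₀ => Matrix.of fun i j => x t₀ j i t, fun t₀ ht₀ => ?_, fun t₀ ht₀ i j c d hle hcd => ?_,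
    fun t₀ ht₀ => ?_⟩
  · ext i j
    exact (hx t₀ j ht₀).1 i
  · exact (hx t₀ j ht₀).2.1 i c d hle hcd
  · filter_upwards [ae_all_iff.2 fun j => (hx t₀ j ht₀).2.2] with t ht i j
    simpa only [Matrix.mul_apply, Matrix.of_apply] using ht j i

theorem IsTransitionMatrix.isTotallyPositive {Φ : ℝ → ℝ → Matrix (Fin n) (Fin n) ℝ}
    (hΦ : IsTransitionMatrix a b A Φ) (hA : IsLocEssBddMeas a b A)
    (hM : ∀ᵐ t ∂(volume.restrict (timeInterval a b)), (A t).IsMPlus) {δ : ℝ} (hδ : 0 < δ)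
    (hlow : ∀ᵐ t ∂(volume.restrict (timeInterval a b)),
      ∀ i j : Fin n, |(i : ℤ) - (j : ℤ)| = 1 → δ ≤ A t i j)
    {t₀ t : ℝ} (ht₀ : t₀ ∈ timeInterval a b) (ht : t ∈ timeInterval a b) (hlt : t₀ < t) :
    (Φ t t₀).IsTotallyPositive := by
  intro k r c
  have hsub : Icc t₀ t ⊆ timeInterval a b := (ordConnected_timeInterval a b).out ht₀ ht
  obtain ⟨K, -, hK⟩ := hA.exists_bound hsub
  have hmeas := (isOpen_timeInterval a b).measurableSet
  rw [ae_restrict_iff' hmeas] at hM hlow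
  have hode := (ae_restrict_iff' hmeas).1 (hΦ.ode t₀ ht₀)
  -- The columns `c` stay fixed and the row tuple is the component index; the component `i₀ = c`
  -- starts at 1.
  refine pos_of_hasDerivAt_metzler (K := k * (n * K)) (δ := δ) (adj := minorAdj) (i₀ := c)
    (y := fun (r : Fin k ↪o Fin n) s => ((Φ s t₀).submatrix r c).det) (Q := fun s (r r' : Fin k ↪o Fin n) => (A s).addCompound r r')
    hδ hlt (fun r => ?_) ?_ ?_ ?_ ?_ (fun r => ?_) ?_ (reflTransGen_minorAdj r c)
  · exact .det fun i j => hΦ.locallyAC t₀ ht₀ _ _ _ _ hlt.le hsub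
  · filter_upwards [hM, hode] with s hMs hs hsm r
    have := Matrix.sum_det_updateRow_eq_addCompound (hMs (hsub hsm)).1
      ((Φ s t₀).submatrix id c) r
    simp only [Matrix.submatrix_submatrix, Function.id_comp, Function.comp_id] at this
    rw [← this]
    exact Matrix.hasDerivAt_det (M := fun s => (Φ s t₀).submatrix r c)
      (M' := fun i => (A s * (Φ s t₀).submatrix id c) (r i))
      fun i j => hs (hsub hsm) (r i) (c j)
  · filter_upwards [hM] with s hMs hsm r r' hr using (hMs (hsub hsm)).addCompound_nonneg hr
  · filter_upwards [hK] with s hs hsm r r' using Matrix.abs_addCompound_le (hs hsm) r r'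
  · filter_upwards [hM, hlow] with s hMs hs hsm r r' hr
    exact (hMs (hsub hsm)).le_addCompound (hs (hsub hsm)) hr
  · simpa only [hΦ.initial t₀ ht₀] using det_one_submatrix_nonneg r c
  · simp [hΦ.initial t₀ ht₀, Matrix.submatrix_one c c.injective]

end

theorem mainTheorem4 (n : ℕ) (a b : EReal) (hab : a < b)
    (A : ℝ → Matrix (Fin n) (Fin n) ℝ) (hA : IsLocEssBddMeas a b A)
    (hM : ∀ᵐ t ∂(volume.restrict (timeInterval a b)), (A t).IsMPlus)
    (δ : ℝ) (hδ : 0 < δ)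
    (hlow : ∀ᵐ t ∂(volume.restrict (timeInterval a b)),
      ∀ i j : Fin n, |(i : ℤ) - (j : ℤ)| = 1 → δ ≤ A t i j) :
    IsTPDS a b A :=
  ⟨hA.exists_isTransitionMatrix, fun _ hΦ _ ht₀ _ ht hlt =>
    hΦ.isTotallyPositive hA hM hδ hlow ht₀ ht hlt⟩
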